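/- Let $K(\cdot\mid\cdot)$ denote (plain) conditional Kolmogorov complexity: $K(x\mid y)$ is the least length of a binary string $p$ such that $D(p,y)=x$, where $D$ is any fixed optimal conditional decompressor, i.e. a partial computable function whose complexity function is minimal up to an additive constant among those of all partial computable functions. For an infinite binary sequence $\omega=(\omega_i)_{i\in\mathbb{N}}$ and a finite set $X\subset\mathbb{N}$, let $\omega(X)$ be the binary string of length $\#X$ formed by the bits $\omega_i$, $i\in X$, in increasing order of $i$. Let $\alpha$ be a positive real number less than $1$. There exists an integer $N$ such that for every integer $l$ there exists an infinite binary sequence $\omega$ with the following property: for every finite set $X\subset\mathbb{N}$ of cardinality at least $N$ there is some $t\in X$ with $$K\bigl((X,\omega(X))\mid t,l\bigr)\ \ge\ \alpha\cdot\#X .$$ -/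

import Mathlib

open scoped ENNReal

/-- Plain conditional complexity of `x` given `y` with respect to the conditional decompressor `D`:
the least length of a binary string `p` such that `D`, run on `(p, y)`, halts with output `x`
(it is `⊤` if there is no such `p`). -/
noncomputable def condComplexity {β γ : Type*} (D : List Bool × γ →. β) (x : β) (y : γ) : ℕ∞ :=
  ⨅ (p : List Bool) (_ : x ∈ D (p, y)), (p.length : ℕ∞)

/-- `D` is an optimal conditional decompressor: it is partial computable and, up to an additive
constant, its complexity function is a lower bound for that of every partial computable
conditional decompressor. The conditional Kolmogorov complexity `K(x | y)` is
`condComplexity D x y` for such a `D`. -/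
def IsOptimalDecompressor {β γ : Type*} [Primcodable β] [Primcodable γ]
    (D : List Bool × γ →. β) : Prop :=
  Partrec D ∧ ∀ D' : List Bool × γ →. β, Partrec D' →
    ∃ c : ℕ, ∀ (x : β) (y : γ), condComplexity D x y ≤ condComplexity D' x y + c

/-- The number of leading `true`s of a bit string, and what follows the first `false`. -/
def splitUnary (p : List Bool) : ℕ × List Bool :=
  List.rec (motive := fun _ => ℕ × List Bool) (0, [])
    (fun b q r => bif b then (r.1 + 1, r.2) else (0, q)) p

theorem splitUnary_append (n : ℕ) (p : List Bool) :
    splitUnary (List.replicate n true ++ false :: p) = (n, p) := by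
  induction n with
  | zero => rfl
  | succ n ih =>
    have h : ∀ q : List Bool, splitUnary (true :: q) =
        ((splitUnary q).1 + 1, (splitUnary q).2) := fun _ => rfl
    rw [List.replicate_succ, List.cons_append, h, ih]

theorem splitUnary_computable : Computable splitUnary := by
  apply Primrec.to_comp
  refine (Primrec.list_rec (f := fun p : List Bool => p) (g := fun _ => ((0, []) : ℕ × List Bool))
    (h := fun _ x => bif x.1 then (x.2.2.1 + 1, x.2.2.2) else (0, x.2.1))
    Primrec.id (Primrec.const _) ?_)
  refine Primrec.cond (Primrec.fst.comp Primrec.snd) (Primrec.pair ?_ ?_) (Primrec.pair ?_ ?_)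
  · exact Primrec.succ.comp
      (Primrec.fst.comp (Primrec.snd.comp (Primrec.snd.comp Primrec.snd)))
  · exact Primrec.snd.comp (Primrec.snd.comp (Primrec.snd.comp Primrec.snd))
  · exact Primrec.const _
  · exact Primrec.fst.comp (Primrec.snd.comp Primrec.snd)

/-- Optimal conditional decompressors exist. -/
theorem exists_isOptimalDecompressor (β γ : Type*) [Primcodable β] [Primcodable γ] :
    ∃ D : List Bool × γ →. β, IsOptimalDecompressor D := by
  refine ⟨fun z => (Nat.Partrec.Code.eval (Denumerable.ofNat Nat.Partrec.Code (splitUnary z.1).1)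
      (Encodable.encode ((splitUnary z.1).2, z.2))).bind
        fun v => ((Encodable.decode v : Option β) : Part β), ?_, ?_⟩
  · have hs : Computable fun z : List Bool × γ => splitUnary z.1 :=
      splitUnary_computable.comp Computable.fst
    refine Partrec.bind (Nat.Partrec.Code.eval_part.comp
      ((Computable.ofNat _).comp (Computable.fst.comp hs))
      (Computable.encode.comp ((Computable.snd.comp hs).pair Computable.snd))) ?_
    exact (Computable.ofOption Computable.decode).comp Computable.snd
  · intro D' hD'
    obtain ⟨c, hc⟩ := Nat.Partrec.Code.exists_code.1 hD'
    refine ⟨Encodable.encode c + 1, fun x y => ?_⟩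
    have key : ∀ p : List Bool, x ∈ D' (p, y) → x ∈ ((Nat.Partrec.Code.eval
        (Denumerable.ofNat Nat.Partrec.Code (splitUnary
          (List.replicate (Encodable.encode c) true ++ false :: p)).1)
      (Encodable.encode ((splitUnary
        (List.replicate (Encodable.encode c) true ++ false :: p)).2, y))).bind
        fun v => ((Encodable.decode v : Option β) : Part β)) := by
      intro p hp
      rw [splitUnary_append]
      simp only [Denumerable.ofNat_encode, hc, Encodable.encodek, Part.coe_some, Part.bind_some]
      exact Part.mem_bind (Part.mem_map Encodable.encode hp) (by simp)
    unfold condComplexity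
    by_cases hne : ∃ p, x ∈ D' (p, y)
    · have : Nonempty {p : List Bool // x ∈ D' (p, y)} := ⟨⟨_, hne.choose_spec⟩⟩
      rw [iInf_subtype', iInf_subtype', ENat.iInf_add]
      refine le_iInf fun p => (iInf_le _ ⟨_, key p.1 p.2⟩).trans ?_
      simp only [List.length_append, List.length_replicate, List.length_cons]
      norm_cast
      omega
    · push Not at hne
      simp [hne]

/-- The string `ω(X)`: the bits `ω i`, `i ∈ X`, in increasing order of `i`. -/
def subsequenceOn (ω : ℕ → Bool) (X : Finset ℕ) : List Bool :=
  (X.sort (· ≤ ·)).map ω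

/-- The pair `(X, ω(X))` as a constructive object; the finite set `X` is presented by the list of
its elements in increasing order. -/
def setWithBits (ω : ℕ → Bool) (X : Finset ℕ) : List ℕ × List Bool :=
  (X.sort (· ≤ ·), subsequenceOn ω X)

/-! Forbid a pair `(X, Y)` with `Y ⊆ X` when `#X ≥ N` and the bits of `Y` on `X` have complexity
below `α * #X` given `(t, l)` for every `t ∈ X`. Counting programs with condition `(t, l)` shows
that at most `2 ^ ⌈α n⌉` forbidden pairs of size `n` pass through a given `t`, whatever `l` is.

Let `f S` be the number of subsets of `S` that avoid all forbidden pairs, and fix `2 ^ α < c < 2`.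
The claim is `f (S ∪ {t}) ≥ c * f S`, by induction on `#S`. Of the `2 * f S` candidate extensions,
those spoiled by `(X, Y)` are determined by their part outside `X`, so they number at most `f (S \
X)`, which is at most `c ^ (1 - #X) * f S` by induction. The weights `c ^ (1 - #X)` through `t` are
bounded by the tail of a geometric series of ratio `2 ^ α / c`, hence by `2 - c` for large `N`
(`mul_card_avoidingSubsets_le`, `exists_sum_weight_le`). So `f` never vanishes, and compactness of
Cantor space yields `ω` (`exists_sequence_avoiding`). -/

/-! ### Growth of the number of avoiding subsets -/

open Classical in
/-- The subsets `A` of `S` such that no pair `(X, A ∩ X)` with `X ⊆ S` is forbidden. -/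
noncomputable def avoidingSubsets (Bad : Finset ℕ → Finset ℕ → Prop) (S : Finset ℕ) :
    Finset (Finset ℕ) :=
  S.powerset.filter fun A => ∀ X ⊆ S, ¬ Bad X (A ∩ X)

theorem mem_avoidingSubsets {Bad : Finset ℕ → Finset ℕ → Prop} {S A : Finset ℕ} :
    A ∈ avoidingSubsets Bad S ↔ A ⊆ S ∧ ∀ X ⊆ S, ¬ Bad X (A ∩ X) := by
  simp [avoidingSubsets]

theorem inter_mem_avoidingSubsets {Bad : Finset ℕ → Finset ℕ → Prop} {S S' A : Finset ℕ}
    (hA : A ∈ avoidingSubsets Bad S) (h : S' ⊆ S) : A ∩ S' ∈ avoidingSubsets Bad S' := by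
  rw [mem_avoidingSubsets] at hA ⊢
  refine ⟨Finset.inter_subset_right, fun X hX => ?_⟩
  rw [Finset.inter_assoc, Finset.inter_eq_right.2 hX]
  exact hA.2 X (hX.trans h)

/-- If one-element extensions inside `S` multiply the number of avoiding subsets by at least `c`,
then so do extensions by several elements. -/
theorem pow_mul_card_avoidingSubsets_le {Bad : Finset ℕ → Finset ℕ → Prop} {c : ℝ} (hc : 0 < c)
    {S : Finset ℕ}
    (h : ∀ R t, t ∉ R → insert t R ⊆ S →
      c * (avoidingSubsets Bad R).card ≤ (avoidingSubsets Bad (insert t R)).card)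
    (R E : Finset ℕ) (hd : Disjoint R E) (hS : R ∪ E ⊆ S) :
    c ^ E.card * (avoidingSubsets Bad R).card ≤ (avoidingSubsets Bad (R ∪ E)).card := by
  induction E using Finset.induction_on with
  | empty => simp
  | insert t E ht ih =>
    rw [Finset.disjoint_insert_right] at hd
    rw [Finset.union_insert] at hS ⊢
    have h1 := ih hd.2 ((Finset.subset_insert _ _).trans hS)
    have h2 := h (R ∪ E) t (by simp [hd.1, ht]) hS
    rw [Finset.card_insert_of_notMem ht, pow_succ']
    calc c * c ^ E.card * (avoidingSubsets Bad R).card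
        = c * (c ^ E.card * (avoidingSubsets Bad R).card) := by ring
      _ ≤ c * (avoidingSubsets Bad (R ∪ E)).card := by gcongr
      _ ≤ _ := h2

open Classical in
/-- Every avoiding subset of `S` extends in two ways to `insert t S`; the extensions that fail
contain a forbidden pair through `t`. -/
theorem two_mul_card_avoidingSubsets_le (Bad : Finset ℕ → Finset ℕ → Prop) {S : Finset ℕ} {t : ℕ}
    (ht : t ∉ S) :
    2 * (avoidingSubsets Bad S).card ≤ (avoidingSubsets Bad (insert t S)).card +
      ∑ P ∈ ((insert t S).powerset ×ˢ (insert t S).powerset).filter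
        (fun P => t ∈ P.1 ∧ P.2 ⊆ P.1 ∧ Bad P.1 P.2), (avoidingSubsets Bad (S \ P.1)).card := by
  set T := ((insert t S).powerset ×ˢ (insert t S).powerset).filter
        (fun P => t ∈ P.1 ∧ P.2 ⊆ P.1 ∧ Bad P.1 P.2) with hT
  set V := avoidingSubsets Bad S with hV
  have hVt : ∀ A ∈ V, t ∉ A := fun A hA h => ht ((mem_avoidingSubsets.1 hA).1 h)
  have hdisj : Disjoint V (V.image (insert t)) := by
    rw [Finset.disjoint_left]
    intro A hA hA'
    obtain ⟨B, -, rfl⟩ := Finset.mem_image.1 hA'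
    exact hVt _ hA (Finset.mem_insert_self _ _)
  have hcard : (V ∪ V.image (insert t)).card = 2 * V.card := by
    rw [Finset.card_union_of_disjoint hdisj, Finset.card_image_of_injOn, two_mul]
    intro A hA B hB hAB
    rw [← Finset.erase_insert (hVt A hA), ← Finset.erase_insert (hVt B hB)]
    exact congrArg (fun C => C.erase t) hAB
  -- A failing `A` meets some `X` in a forbidden pair, with `t ∈ X` because `A ∩ S` avoids
  -- everything inside `S`. It is recovered from `A ∩ X` and its trace on `S \ X`, which is again
  -- avoiding.
  have hsub : V ∪ V.image (insert t) ⊆ avoidingSubsets Bad (insert t S) ∪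
      T.biUnion fun P => (avoidingSubsets Bad (S \ P.1)).image (· ∪ P.2) := by
    intro A hA
    have hAS : A ⊆ insert t S ∧ A ∩ S ∈ V := by
      rcases Finset.mem_union.1 hA with h | h
      · have h' := (mem_avoidingSubsets.1 h).1
        exact ⟨h'.trans (Finset.subset_insert _ _), by rwa [Finset.inter_eq_left.2 h']⟩
      · obtain ⟨B, hB, rfl⟩ := Finset.mem_image.1 h
        have h' := (mem_avoidingSubsets.1 hB).1
        exact ⟨Finset.insert_subset_insert _ h', by
          rwa [Finset.insert_inter_of_notMem ht, Finset.inter_eq_left.2 h']⟩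
    by_cases hgood : A ∈ avoidingSubsets Bad (insert t S)
    · exact Finset.mem_union_left _ hgood
    · rw [mem_avoidingSubsets] at hgood
      push Not at hgood
      obtain ⟨X, hX, hbad⟩ := hgood hAS.1
      have htX : t ∈ X := by
        by_contra htX
        have hXS : X ⊆ S := (Finset.subset_insert_iff_of_notMem htX).1 hX
        refine (mem_avoidingSubsets.1 hAS.2).2 X hXS ?_
        rwa [Finset.inter_assoc, Finset.inter_eq_right.2 hXS]
      refine Finset.mem_union_right _ (Finset.mem_biUnion.2 ⟨(X, A ∩ X), ?_, ?_⟩)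
      · simp only [hT, Finset.mem_filter, Finset.mem_product, Finset.mem_powerset]
        exact ⟨⟨hX, Finset.inter_subset_right.trans hX⟩, htX, Finset.inter_subset_right, hbad⟩
      · refine Finset.mem_image.2 ⟨A ∩ S ∩ (S \ X),
          inter_mem_avoidingSubsets hAS.2 Finset.sdiff_subset, ?_⟩
        ext i
        have := @hAS.1 i
        simp only [Finset.mem_union, Finset.mem_inter, Finset.mem_sdiff, Finset.mem_insert] at this ⊢
        by_cases hi : i ∈ X
        · simp [hi]
        · have : i ≠ t := fun h => hi (h ▸ htX)
          tauto
  rw [← hcard]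
  refine (Finset.card_le_card hsub).trans ((Finset.card_union_le _ _).trans ?_)
  gcongr
  exact Finset.card_biUnion_le.trans (Finset.sum_le_sum fun P _ => Finset.card_image_le)

/-- If the forbidden pairs through each point have small total weight, adding a point multiplies
the number of avoiding subsets by at least `c`. -/
theorem mul_card_avoidingSubsets_le {Bad : Finset ℕ → Finset ℕ → Prop} {c : ℝ} (hc : 0 < c)
    (hw : ∀ t, ∀ T : Finset (Finset ℕ × Finset ℕ),
      (∀ P ∈ T, t ∈ P.1 ∧ P.2 ⊆ P.1 ∧ Bad P.1 P.2) → ∑ P ∈ T, c * c⁻¹ ^ P.1.card ≤ 2 - c)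
    (n : ℕ) (S : Finset ℕ) (hn : S.card = n) (t : ℕ) (ht : t ∉ S) :
    c * (avoidingSubsets Bad S).card ≤ (avoidingSubsets Bad (insert t S)).card := by
  classical
  induction n using Nat.strong_induction_on generalizing S t with
  | _ n ih =>
    -- Any `R` with `u ∉ R` and `insert u R ⊆ S` is strictly smaller than `S`, so the induction
    -- hypothesis covers all one-point extensions inside `S`.
    have hpow := pow_mul_card_avoidingSubsets_le (Bad := Bad) hc (S := S) fun R u hu hR =>
      ih R.card (by
        have := Finset.card_le_card hR
        rw [Finset.card_insert_of_notMem hu] at this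
        omega) R rfl u hu
    have hmain := two_mul_card_avoidingSubsets_le Bad ht
    set T := ((insert t S).powerset ×ˢ (insert t S).powerset).filter
        (fun P => t ∈ P.1 ∧ P.2 ⊆ P.1 ∧ Bad P.1 P.2) with hT
    -- `S` arises from `S \ P.1` by adding the points of `P.1` other than `t`; hence the exponent
    -- `#P.1 - 1`, written as `c * c⁻¹ ^ #P.1`.
    have hterm : ∀ P ∈ T, ((avoidingSubsets Bad (S \ P.1)).card : ℝ) ≤
        c * c⁻¹ ^ P.1.card * (avoidingSubsets Bad S).card := by
      intro P hP
      simp only [hT, Finset.mem_filter, Finset.mem_product, Finset.mem_powerset] at hP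
      have hE : P.1.erase t ⊆ S := by
        intro i hi
        rw [Finset.mem_erase] at hi
        exact Finset.mem_of_mem_insert_of_ne (hP.1.1 hi.2) hi.1
      have hU : S \ P.1 ∪ P.1.erase t = S := by
        ext i
        have := @hE i
        simp only [Finset.mem_union, Finset.mem_sdiff, Finset.mem_erase] at this ⊢
        by_cases hi : i = t
        · subst hi; simp [ht]
        · tauto
      have h := hpow (S \ P.1) (P.1.erase t)
        (Finset.disjoint_of_subset_right (Finset.erase_subset _ _) Finset.sdiff_disjoint) hU.subset
      rw [hU] at h
      have hcard := Finset.card_erase_add_one hP.2.1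
      rw [← hcard, pow_succ]
      calc ((avoidingSubsets Bad (S \ P.1)).card : ℝ)
          = c⁻¹ ^ (P.1.erase t).card *
              (c ^ (P.1.erase t).card * (avoidingSubsets Bad (S \ P.1)).card) := by
            rw [← mul_assoc, ← mul_pow, inv_mul_cancel₀ hc.ne', one_pow, one_mul]
        _ ≤ c⁻¹ ^ (P.1.erase t).card * (avoidingSubsets Bad S).card := by gcongr
        _ = _ := by field_simp
    have hsum := Finset.sum_le_sum hterm
    rw [← Finset.sum_mul] at hsum
    have hwT := hw t T fun P hP => (Finset.mem_filter.1 hP).2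
    have hwS := mul_le_mul_of_nonneg_right hwT (Nat.cast_nonneg (α := ℝ) (avoidingSubsets Bad S).card)
    have hmain' : (2 : ℝ) * (avoidingSubsets Bad S).card ≤
        (avoidingSubsets Bad (insert t S)).card +
          ∑ P ∈ T, ((avoidingSubsets Bad (S \ P.1)).card : ℝ) := by exact_mod_cast hmain
    linarith

/-! ### Compactness -/

/-- If the forbidden pairs through each point have small total weight, some infinite sequence
avoids all of them. -/
theorem exists_sequence_avoiding {Bad : Finset ℕ → Finset ℕ → Prop} {c : ℝ} (hc : 0 < c)
    (hempty : ¬ Bad ∅ ∅)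
    (hw : ∀ t, ∀ T : Finset (Finset ℕ × Finset ℕ),
      (∀ P ∈ T, t ∈ P.1 ∧ P.2 ⊆ P.1 ∧ Bad P.1 P.2) → ∑ P ∈ T, c * c⁻¹ ^ P.1.card ≤ 2 - c) :
    ∃ ω : ℕ → Bool, ∀ X : Finset ℕ, ¬ Bad X (X.filter fun i => ω i = true) := by
  have hne : ∀ S : Finset ℕ, (avoidingSubsets Bad S).Nonempty := by
    intro S
    have h := pow_mul_card_avoidingSubsets_le (Bad := Bad) hc (S := S)
      (fun R t ht _ => mul_card_avoidingSubsets_le hc hw R.card R rfl t ht) ∅ S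
      (Finset.disjoint_empty_left _) (by simp)
    have h0 : 0 < (avoidingSubsets Bad ∅).card :=
      Finset.card_pos.2 ⟨∅, mem_avoidingSubsets.2 ⟨subset_rfl, fun X hX => by
        rw [Finset.subset_empty.1 hX]; exact hempty⟩⟩
    rw [Finset.empty_union] at h
    rw [← Finset.card_pos, ← Nat.cast_pos (α := ℝ)]
    exact lt_of_lt_of_le (by positivity) h
  -- Each condition depends only on the finitely many coordinates in `X`.
  have hclosed : ∀ X : Finset ℕ,
      IsClosed {ω : ℕ → Bool | ¬ Bad X (X.filter fun i => ω i = true)} := by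
    intro X
    have hcont : Continuous fun ω : ℕ → Bool => fun i : X => ω i := by fun_prop
    have : {ω : ℕ → Bool | ¬ Bad X (X.filter fun i => ω i = true)} =
        (fun ω : ℕ → Bool => fun i : X => ω i) ⁻¹'
          {σ : X → Bool | ¬ Bad X ((X.attach.filter fun i => σ i = true).map
            (Function.Embedding.subtype _))} := by
      ext ω
      simp only [Set.mem_ofPred_eq, Set.mem_preimage]
      have : X.filter (fun i => ω i = true) = (X.attach.filter fun i : X => ω i = true).map
            (Function.Embedding.subtype _) := by
        ext i
        simp [and_comm]
      rw [← this]
    rw [this]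
    exact (isClosed_discrete _).preimage hcont
  obtain ⟨ω, hω⟩ : (⋂ X : Finset ℕ,
      {ω : ℕ → Bool | ¬ Bad X (X.filter fun i => ω i = true)}).Nonempty := by
    -- Finitely many conditions are met at once by an avoiding subset of the union of their sets
    -- `X`.
    refine CompactSpace.iInter_nonempty hclosed fun u => ?_
    obtain ⟨A, hA⟩ := hne (u.biUnion id)
    refine ⟨fun i => decide (i ∈ A), Set.mem_iInter₂.2 fun X hX => ?_⟩
    have := (mem_avoidingSubsets.1 hA).2 X (Finset.subset_biUnion_of_mem id hX)
    simpa [Finset.filter_mem_eq_inter, Finset.inter_comm] using this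
  exact ⟨ω, fun X => Set.mem_iInter.1 hω X⟩

/-! ### Counting objects of small complexity -/

/-- There are fewer than `2 ^ k` binary strings of length less than `k`. -/
theorem card_le_two_pow_of_length_lt {k : ℕ} (F : Finset (List Bool))
    (hF : ∀ p ∈ F, p.length < k) : F.card ≤ 2 ^ k := by
  have hsub : F ⊆ (Finset.range k).biUnion fun j =>
      (Finset.univ : Finset (List.Vector Bool j)).image List.Vector.toList := by
    intro p hp
    exact Finset.mem_biUnion.2 ⟨p.length, Finset.mem_range.2 (hF p hp),
      Finset.mem_image.2 ⟨(⟨p, rfl⟩ : List.Vector Bool p.length), Finset.mem_univ _, rfl⟩⟩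
  calc F.card ≤ _ := Finset.card_le_card hsub
    _ ≤ ∑ j ∈ Finset.range k, 2 ^ j :=
      Finset.card_biUnion_le.trans (Finset.sum_le_sum fun j _ =>
        Finset.card_image_le.trans (by simp [card_vector]))
    _ ≤ 2 ^ k := by
      rw [Nat.geomSum_eq le_rfl]
      simp

/-- The number of objects of conditional complexity less than `k` is at most `2 ^ k`. -/
theorem card_le_two_pow_of_condComplexity_lt {ι β γ : Type*} (D : List Bool × γ →. β) (y : γ)
    {k : ℕ} (T : Finset ι) (f : ι → β) (hf : Set.InjOn f T)
    (hT : ∀ i ∈ T, condComplexity D (f i) y < k) : T.card ≤ 2 ^ k := by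
  classical
  have hp : ∀ i ∈ T, ∃ p : List Bool, f i ∈ D (p, y) ∧ p.length < k := by
    intro i hi
    have h := hT i hi
    simp only [condComplexity, iInf_lt_iff] at h
    obtain ⟨p, hp, hlt⟩ := h
    exact ⟨p, hp, by exact_mod_cast hlt⟩
  choose! p hpD hpk using hp
  rw [← Finset.card_image_of_injOn (f := p) (s := T)]
  · refine card_le_two_pow_of_length_lt _ fun q hq => ?_
    obtain ⟨i, hi, rfl⟩ := Finset.mem_image.1 hq
    exact hpk i hi
  · intro i hi j hj hij
    refine hf hi hj (Part.mem_unique (hpD i hi) ?_)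
    rw [hij]
    exact hpD j hj

theorem setWithBits_congr {ω ω' : ℕ → Bool} {X : Finset ℕ} (h : ∀ i ∈ X, ω i = ω' i) :
    setWithBits ω X = setWithBits ω' X := by
  simp only [setWithBits, subsequenceOn, Prod.mk.injEq, true_and]
  exact List.map_congr_left fun i hi => h i ((Finset.mem_sort _).1 hi)

theorem setWithBits_inj {ω ω' : ℕ → Bool} {X X' : Finset ℕ}
    (h : setWithBits ω X = setWithBits ω' X') : X = X' ∧ ∀ i ∈ X, ω i = ω' i := by
  simp only [setWithBits, subsequenceOn, Prod.mk.injEq] at h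
  have hX : X = X' := by
    ext i
    rw [← Finset.mem_sort (· ≤ ·), h.1, Finset.mem_sort]
  subst hX
  exact ⟨rfl, fun i hi => List.map_inj_left.1 h.2 i ((Finset.mem_sort _).2 hi)⟩

/-! ### Geometric weights -/

/-- A family with at most `2 ^ ⌈α n⌉` members of each size `n` and none of size below `N` has
small weight for the geometric weights `c⁻¹ ^ n`, when `2 ^ α < c` and `N` is large. -/
theorem exists_sum_weight_le {α c ε : ℝ} (hα : 0 < α) (hc : (2 : ℝ) ^ α < c) (hε : 0 < ε) :
    ∃ N : ℕ, 0 < N ∧ ∀ {ι : Type} (T : Finset ι) (s : ι → ℕ), (∀ i ∈ T, N ≤ s i) →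
      (∀ n, (T.filter fun i => s i = n).card ≤ 2 ^ ⌈α * n⌉₊) →
      ∑ i ∈ T, c * c⁻¹ ^ s i ≤ ε := by
  have ha : (0 : ℝ) < 2 ^ α := by positivity
  have hc0 : 0 < c := ha.trans hc
  set r : ℝ := 2 ^ α / c with hr
  have hr0 : 0 < r := by positivity
  have hr1 : r < 1 := (div_lt_one hc0).2 hc
  have hsum : Summable fun n : ℕ => 2 * c * r ^ n :=
    (summable_geometric_of_lt_one hr0.le hr1).mul_left _
  obtain ⟨N, hN⟩ := ((tendsto_order.1 (tendsto_sum_nat_add fun n : ℕ => 2 * c * r ^ n)).2 ε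
    hε |>.and (Filter.eventually_gt_atTop 0)).exists
  refine ⟨N, hN.2, fun {ι} T s hs hcard => ?_⟩
  have hpow : ∀ n : ℕ, (2 : ℝ) ^ ⌈α * n⌉₊ * (c * c⁻¹ ^ n) ≤ 2 * c * r ^ n := by
    intro n
    -- Rounding the exponent up costs at most a factor `2`.
    have h1 : (2 : ℝ) ^ ⌈α * n⌉₊ ≤ 2 * (2 ^ α) ^ n := by
      rw [← Real.rpow_natCast, ← Real.rpow_natCast, ← Real.rpow_mul (by norm_num)]
      rw [← Real.rpow_one_add' (by norm_num) (by positivity)]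
      refine Real.rpow_le_rpow_of_exponent_le (by norm_num) ?_
      have := Nat.ceil_lt_add_one (a := α * n) (by positivity)
      linarith
    calc (2 : ℝ) ^ ⌈α * n⌉₊ * (c * c⁻¹ ^ n) ≤ 2 * (2 ^ α) ^ n * (c * c⁻¹ ^ n) := by gcongr
      _ = _ := by rw [hr, div_pow, inv_pow]; ring
  set M := T.sup s + 1 with hM
  have hmaps : ∀ i ∈ T, s i ∈ Finset.Ico N (N + M) := fun i hi =>
    Finset.mem_Ico.2 ⟨hs i hi, by have := Finset.le_sup (f := s) hi; omega⟩
  rw [← Finset.sum_fiberwise_of_maps_to hmaps]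
  calc ∑ n ∈ Finset.Ico N (N + M), ∑ i ∈ T with s i = n, c * c⁻¹ ^ s i
      ≤ ∑ n ∈ Finset.Ico N (N + M), 2 * c * r ^ n := by
        refine Finset.sum_le_sum fun n _ => le_trans ?_ (hpow n)
        rw [Finset.sum_congr rfl (g := fun _ => c * c⁻¹ ^ n) fun i hi => by
          rw [(Finset.mem_filter.1 hi).2], Finset.sum_const, nsmul_eq_mul]
        gcongr
        exact_mod_cast hcard n
    _ = ∑ k ∈ Finset.range M, 2 * c * r ^ (k + N) := by
        rw [Finset.sum_Ico_eq_sum_range]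
        simp [add_comm]
    _ ≤ ∑' k : ℕ, 2 * c * r ^ (k + N) :=
        ((summable_nat_add_iff N).2 hsum).sum_le_tsum _ fun _ _ => by positivity
    _ ≤ ε := hN.1.le

/-! ### The forbidden pairs of low complexity -/

theorem theorem4
    (D : List Bool × (ℕ × ℤ) →. List ℕ × List Bool) (hD : IsOptimalDecompressor D)
    (α : ℝ) (hα0 : 0 < α) (hα1 : α < 1) :
    ∃ N : ℕ, ∀ l : ℤ, ∃ ω : ℕ → Bool, ∀ X : Finset ℕ, N ≤ X.card →
      ∃ t ∈ X, ENNReal.ofReal (α * X.card) ≤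
        (condComplexity D (setWithBits ω X) (t, l) : ℝ≥0∞) := by
  have h2 : (2 : ℝ) ^ α < 2 := by
    simpa using Real.rpow_lt_rpow_of_exponent_lt (x := 2) (by norm_num) hα1
  -- `c > 2 ^ α` makes the weights summable; `c < 2` leaves the positive allowance `2 - c` for them.
  obtain ⟨c, hc, hc2⟩ := exists_between h2
  have hc0 : 0 < c := lt_trans (by positivity) hc
  obtain ⟨N, hN0, hN⟩ := exists_sum_weight_le hα0 hc (sub_pos.2 hc2)
  refine ⟨N, fun l => ?_⟩
  obtain ⟨ω, hω⟩ := exists_sequence_avoiding (c := c)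
    (Bad := fun X Y => N ≤ X.card ∧ ∀ t ∈ X,
      (condComplexity D (setWithBits (fun i => decide (i ∈ Y)) X) (t, l) : ℝ≥0∞) <
        ENNReal.ofReal (α * X.card))
    -- The quantifier over `t ∈ X` is vacuous for `X = ∅`, so `0 < N` is what keeps the empty pair
    -- from being forbidden.
    hc0 (fun h => by simp at h; omega) (fun t T hT => by
      refine hN T (fun P => P.1.card) (fun P hP => (hT P hP).2.2.1) fun n => ?_
      refine card_le_two_pow_of_condComplexity_lt D (t, l) _
        (fun P => setWithBits (fun i => decide (i ∈ P.2)) P.1) ?_ ?_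
      -- The bits on `P.1` determine `P.2` because `P.2 ⊆ P.1`.
      · intro P hP Q hQ hPQ
        obtain ⟨h1, h3⟩ := setWithBits_inj hPQ
        have hPs := (hT P (Finset.mem_filter.1 hP).1).2.1
        have hQs := (hT Q (Finset.mem_filter.1 hQ).1).2.1
        refine Prod.ext h1 (Finset.ext fun i => ⟨fun hi => ?_, fun hi => ?_⟩)
        · exact (decide_eq_decide.1 (h3 i (hPs hi))).1 hi
        · exact (decide_eq_decide.1 (h3 i (h1 ▸ hQs hi))).2 hi
      · intro P hP
        obtain ⟨hPT, rfl⟩ := Finset.mem_filter.1 hP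
        have h := (hT P hPT).2.2.2 t (hT P hPT).1
        rw [← ENat.toENNReal_lt]
        refine h.trans_le ?_
        rw [ENat.toENNReal_coe, ENNReal.ofReal_le_natCast]
        exact Nat.le_ceil _)
  refine ⟨ω, fun X hX => ?_⟩
  by_contra hcon
  push Not at hcon
  refine hω X ⟨hX, fun t ht => ?_⟩
  have : setWithBits (fun i => decide (i ∈ X.filter fun i => ω i = true)) X = setWithBits ω X :=
    setWithBits_congr fun i hi => by simp [hi]
  rw [this]
  exact hcon t ht
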